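/- All graphs are finite and simple. A \emph{Helly EPT representation} of a graph $G$ consists of a finite tree $T$ (the host tree) and a family $(P_v)_{v\in V(G)}$ of subpaths of $T$ such that two distinct vertices $v,w$ of $G$ are adjacent if and only if $E(P_v)\cap E(P_w)\neq\emptyset$, and such that the family $(E(P_v))_{v\in V(G)}$ has the Helly property: every non-empty subfamily of pairwise intersecting members has non-empty total intersection. A graph is \emph{Helly EPT} if it has such a representation, and it belongs to the class Helly $[h,2,2]$ if it has such a representation whose host tree has maximum degree $h$. A \emph{clique} is an inclusion-maximal set of pairwise adjacent vertices. A clique $C$ of a connected graph $H$ is a \emph{separator} of $H$ if $H-C$ is disconnected (the graph without vertices is not disconnected); an \emph{atom} is a connected non-empty graph without separators. A \emph{clique decomposition tree} of a connected graph $H$ is obtained as follows: if $H$ is an atom, it is a single leaf carrying $H$; otherwise choose a separator $C$ of $H$, which is carried by the root, and attach to the root, for each connected component $K$ of $H-C$, a clique decomposition tree of the induced subgraph $H[C\cup V(K)]$. Fix one clique decomposition tree for each connected component of $G$ (a single one if $G$ is connected); the \emph{atoms of $G$} are the graphs carried by their leaves. \textbf{Theorem.} Let $G$ be a Helly EPT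 graph and let $h\ge 3$ be an integer. Then, for every choice of the clique decomposition trees, $G$ belongs to Helly $[h,2,2]$ if and only if every atom of $G$ has at most $h$ cliques. -/

import Mathlib

namespace HellyEPT

universe u

/-- A family of sets has the Helly property if every non-empty, pairwise intersecting subfamily
has non-empty total intersection. -/
def HellyProperty {ι α : Type*} (S : ι → Set α) : Prop :=
  ∀ I : Set ι, I.Nonempty → I.Pairwise (fun i j => (S i ∩ S j).Nonempty) →
    (⋂ i ∈ I, S i).Nonempty

/-- An edge-intersection representation of `G` by a family of subpaths, one for each vertex of `G`,
of the host graph `T` (which is required to be a tree wherever this is used). -/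
structure PathRep {V : Type*} {W : Type*} (G : SimpleGraph V) (T : SimpleGraph W) where
  src : V → W
  tgt : V → W
  path : ∀ v, T.Walk (src v) (tgt v)
  isPath : ∀ v, (path v).IsPath
  adj_iff : ∀ v w, G.Adj v w ↔ v ≠ w ∧ ((path v).edgeSet ∩ (path w).edgeSet).Nonempty

/-- `G` admits an EPT representation on a finite host tree whose family of edge sets of paths has
the Helly property. -/
def IsHellyEPT {V : Type*} (G : SimpleGraph V) : Prop :=
  ∃ (W : Type) (_ : Fintype W) (T : SimpleGraph W) (_ : T.IsTree) (R : PathRep G T),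
    HellyProperty (fun v => (R.path v).edgeSet)

/-- The class Helly `[h,2,2]`: as `IsHellyEPT`, on a finite host tree of maximum degree `h`. -/
def IsHellyDeg {V : Type*} (G : SimpleGraph V) (h : ℕ) : Prop :=
  ∃ (W : Type) (_ : Fintype W) (T : SimpleGraph W) (_ : DecidableRel T.Adj) (_ : T.IsTree)
    (_ : T.maxDegree = h) (R : PathRep G T), HellyProperty (fun v => (R.path v).edgeSet)

/-- `C` is a clique, i.e. an inclusion-maximal complete set, of the induced subgraph `G[A]`. -/
def IsMaxClique {V : Type*} (G : SimpleGraph V) (A C : Set V) : Prop :=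
  Maximal (fun S : Set V => S ⊆ A ∧ G.IsClique S) C

/-- The clique `C` of the connected graph `G[A]` is a separator: `G[A \ C]` is not connected.
(`Preconnected` counts the graph without vertices as connected, so a complete graph has no
separator.) -/
def IsSeparator {V : Type*} (G : SimpleGraph V) (A C : Set V) : Prop :=
  (G.induce A).Connected ∧ IsMaxClique G A C ∧ ¬ (G.induce (A \ C)).Preconnected

/-- `G[A]` is an atom: a connected graph without separators. -/
def IsAtomSet {V : Type*} (G : SimpleGraph V) (A : Set V) : Prop :=
  (G.induce A).Connected ∧ ∀ C : Set V, ¬ IsSeparator G A C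

/-- The clique decomposition trees of `G[A]`. A leaf carries an atom. An internal node carries a
separator `C` of `G[A]`, and has one child for each connected component `K` of `G[A \ C]`: a clique
decomposition tree of `G[C ∪ K]`. -/
inductive CliqueDecompTree {V : Type u} (G : SimpleGraph V) : Set V → Type u
  | leaf (A : Set V) (hA : IsAtomSet G A) : CliqueDecompTree G A
  | node (A C : Set V) (hC : IsSeparator G A C)
      (child : ∀ K : (G.induce (A \ C)).ConnectedComponent,
        CliqueDecompTree G (C ∪ Subtype.val '' K.supp)) : CliqueDecompTree G A

/-- The (vertex sets of the) atoms at the leaves of a clique decomposition tree. -/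
def CliqueDecompTree.atoms {V : Type u} {G : SimpleGraph V} {A : Set V} :
    CliqueDecompTree G A → Set (Set V)
  | .leaf A _ => {A}
  | .node _ _ _ child => ⋃ K, (child K).atoms

/-- Every finite connected graph has a clique decomposition tree. -/
theorem nonempty_cliqueDecompTree {V : Type u} [Finite V] (G : SimpleGraph V) (A : Set V)
    (hA : (G.induce A).Connected) : Nonempty (CliqueDecompTree G A) := by
  induction hn : A.ncard using Nat.strong_induction_on generalizing A with
  | _ n ih =>
  subst hn
  by_cases hat : ∀ C : Set V, ¬ IsSeparator G A C
  · exact ⟨.leaf A ⟨hA, hat⟩⟩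
  push Not at hat
  obtain ⟨C, hC⟩ := hat
  have hCA : C ⊆ A := hC.2.1.prop.1
  have hcl : G.IsClique C := hC.2.1.prop.2
  obtain ⟨c₀, hc₀⟩ : C.Nonempty := by
    by_contra hne
    rw [Set.not_nonempty_iff_eq_empty] at hne
    obtain ⟨x⟩ := hA.nonempty
    have := hC.2.1.2 (y := {x.1}) ⟨by simp, by simp⟩ (by simp [hne]) rfl
    simp [hne] at this
  have key : ∀ K : (G.induce (A \ C)).ConnectedComponent,
      Nonempty (CliqueDecompTree G (C ∪ Subtype.val '' K.supp)) := by
    intro K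
    have hsub : C ∪ Subtype.val '' K.supp ⊆ A := by
      rintro x (hx | ⟨y, _, rfl⟩)
      · exact hCA hx
      · exact y.2.1
    refine ih _ ?_ _ ?_ rfl
    · apply Set.ncard_lt_ncard _ (Set.toFinite _)
      refine ⟨hsub, fun hAs => hC.2.2 ?_⟩
      have hall : ∀ y : ↥(A \ C), (G.induce (A \ C)).connectedComponentMk y = K := by
        intro y
        rcases hAs y.2.1 with hy | ⟨z, hz, hzy⟩
        · exact absurd hy y.2.2
        · rw [← Subtype.ext hzy]; exact hz
      intro y z
      exact SimpleGraph.ConnectedComponent.exact ((hall y).trans (hall z).symm)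
    · have hCreach : ∀ x (hx : x ∈ C), (G.induce (C ∪ Subtype.val '' K.supp)).Reachable
          ⟨x, Or.inl hx⟩ ⟨c₀, Or.inl hc₀⟩ := by
        intro x hx
        by_cases hxc : x = c₀
        · subst hxc; exact .refl _
        · exact SimpleGraph.Adj.reachable (hcl hx hc₀ hxc)
      have hK : ∀ (x y : A) (_ : (G.induce A).Walk x y) (_ : y.1 ∈ C)
          (hx : x.1 ∈ C ∪ Subtype.val '' K.supp),
          (G.induce (C ∪ Subtype.val '' K.supp)).Reachable ⟨x.1, hx⟩ ⟨c₀, Or.inl hc₀⟩ := by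
        intro x y p
        induction p with
        | nil => intro hy _; exact hCreach _ hy
        | @cons a b c hab p ihp =>
          intro hy hx
          by_cases haC : a.1 ∈ C
          · exact hCreach _ haC
          have hb : b.1 ∈ C ∪ Subtype.val '' K.supp := by
            by_cases hbC : b.1 ∈ C
            · exact Or.inl hbC
            rcases hx with hx | ⟨z, hz, hza⟩
            · exact absurd hx haC
            refine Or.inr ⟨⟨b.1, b.2, hbC⟩, ?_, rfl⟩
            have hadj : (G.induce (A \ C)).Adj z ⟨b.1, b.2, hbC⟩ := by
              change G.Adj z.1 b.1
              rw [hza]; exact hab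
            exact (SimpleGraph.ConnectedComponent.sound hadj.reachable.symm).trans hz
          exact (SimpleGraph.Adj.reachable (show (G.induce _).Adj ⟨a.1, hx⟩ ⟨b.1, hb⟩ from hab)).trans
            (ihp hy hb)
      have hr : ∀ x, (G.induce (C ∪ Subtype.val '' K.supp)).Reachable x ⟨c₀, Or.inl hc₀⟩ := by
        rintro ⟨x, hx⟩
        obtain ⟨p⟩ := hA.preconnected ⟨x, hsub hx⟩ ⟨c₀, hCA hc₀⟩
        exact hK _ _ p hc₀ hx
      have : Nonempty ↥(C ∪ Subtype.val '' K.supp) := ⟨⟨c₀, Or.inl hc₀⟩⟩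
      exact ⟨fun x y => (hr x).trans (hr y).symm⟩
  exact ⟨.node A C hC fun K => (key K).some⟩

end HellyEPT

namespace HellyEPT

open SimpleGraph

/-! By the Helly property every clique is carried by a single edge of the host tree, so cliques can
be located in the tree.

Necessity. Let `A` be an atom and `f` a host edge. The vertices of `A` whose paths use `f` lie in
one clique `C`; since `C` does not separate `A`, the paths of `A \ C` all stay on one side of `f`,
and so do the host edges of all cliques other than `C` (`exists_side`). Orient each edge towards
that side. A finite tree has fewer edges than vertices, so some vertex `c` is a sink
(`exists_sink`). Beyond each edge at `c` lies at most one clique, and every clique lies beyond some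
edge at `c`; hence there are at most `deg c` cliques.

Sufficiency. Let `c` have degree greater than `h`. For a neighbour `x`, join two other neighbours of
`c` when a path avoiding `cx` passes through both (`link`). If all these links are connected, no
clique can separate the vertices whose paths pass through `c`, so one atom contains them all, and
the edges at `c` give pairwise distinct cliques of it (`exists_atom_degree_le`): more than `h`, a
contradiction. If the link of some `x` is disconnected, split `c` along a component. Only paths
containing `cx` can use the new edge, so no new intersections arise (`exists_split`), and the total
excess of the degrees over three drops (`excess_split_lt`). Iterate, then add pendant vertices to
reach maximum degree exactly `h`. -/

/-! ### Edges separating two vertices of a tree -/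

/-- The edges whose deletion separates `a` from `b`; in a tree these are the edges of the path
from `a` to `b`. -/
def cut {W : Type*} (T : SimpleGraph W) (a b : W) : Set (Sym2 W) :=
  {e | ¬ (T.deleteEdges {e}).Reachable a b}

section Cut

variable {W : Type*} {T : SimpleGraph W} {a b : W}

theorem mem_cut {e : Sym2 W} : e ∈ cut T a b ↔ ¬ (T.deleteEdges {e}).Reachable a b := Iff.rfl

theorem mem_edges_of_mem_cut {e : Sym2 W} (he : e ∈ cut T a b) (p : T.Walk a b) :
    e ∈ p.edges := by
  by_contra h
  exact he ⟨p.toDeleteEdge e h⟩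

theorem cut_subset_edgeSet (hT : T.Connected) : cut T a b ⊆ T.edgeSet := fun _ he => by
  obtain ⟨p⟩ := hT.preconnected a b
  exact p.edges_subset_edgeSet (mem_edges_of_mem_cut he p)

/-- A walk avoiding `e` would shorten to a path avoiding `e`, against uniqueness of paths. Paths are
thereby replaced by their ends and a reachability condition, which is easy to carry over to a
modified tree. -/
theorem edgeSet_eq_cut (hT : T.IsTree) {p : T.Walk a b} (hp : p.IsPath) :
    p.edgeSet = cut T a b := by
  classical
  ext e
  refine ⟨fun he => ?_, fun he => mem_edges_of_mem_cut he p⟩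
  rintro ⟨q⟩
  let q' : T.Walk a b := q.bypass.mapLe (deleteEdges_le {e})
  have hq' : q'.IsPath := (q.bypass_isPath).mapLe _
  have hpq : p = q' := (hT.existsUnique_path a b).unique hp hq'
  rw [hpq, Walk.mem_edgeSet, Walk.edges_mapLe_eq_edges] at he
  have := q.bypass.edges_subset_edgeSet he
  simp at this

/-- A path that avoids `e` stays on one side of `e`. -/
theorem reachable_of_mem_cut {e d : Sym2 W} {x : W} (hd : d ∈ cut T a b) (hx : x ∈ d)
    (he : e ∉ cut T a b) : (T.deleteEdges {e}).Reachable a x := by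
  classical
  rw [mem_cut, not_not] at he
  obtain ⟨q⟩ := he
  -- Since `d` separates `a` from `b`, even the walk `q` avoiding `e` traverses `d`; its initial
  -- part up to `x` is the desired walk.
  have hmem : d ∈ q.edges := by
    have := mem_edges_of_mem_cut hd (q.mapLe (deleteEdges_le {e}))
    rwa [Walk.edges_mapLe_eq_edges] at this
  exact ⟨q.takeUntil x (Walk.mem_support_of_mem_edges hmem hx)⟩

theorem exists_mem_ne {e : Sym2 W} (he : e ∈ T.edgeSet) (c : W) : ∃ b ∈ e, b ≠ c := by
  induction e with | _ p q =>
  by_cases hp : p = c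
  · exact ⟨q, by simp, fun hq => ((mem_edgeSet T).1 he).ne (hp.trans hq.symm)⟩
  · exact ⟨p, by simp, hp⟩

/-- Deleting an edge of a connected graph leaves every vertex connected to one of its ends. -/
theorem reachable_end (hT : T.Connected) (x y z : W) :
    (T.deleteEdges {s(x, y)}).Reachable x z ∨ (T.deleteEdges {s(x, y)}).Reachable y z := by
  obtain ⟨p⟩ := hT.preconnected z x
  suffices h : ∀ u v (_ : T.Walk u v), (v = x) → (T.deleteEdges {s(x, y)}).Reachable x u ∨
      (T.deleteEdges {s(x, y)}).Reachable y u from h z x p rfl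
  intro u v p
  induction p with
  | nil => rintro rfl; exact Or.inl (.refl _)
  | @cons u v w huv p ih =>
    intro hw
    by_cases he : s(u, v) = s(x, y)
    · rcases Sym2.eq_iff.1 he with ⟨rfl, rfl⟩ | ⟨rfl, rfl⟩
      · exact Or.inl (.refl _)
      · exact Or.inr (.refl _)
    · have : (T.deleteEdges {s(x, y)}).Adj v u := by
        rw [deleteEdges_adj]
        exact ⟨huv.symm, by rwa [Set.mem_singleton_iff, Sym2.eq_swap]⟩
      exact (ih hw).imp (·.trans this.reachable) (·.trans this.reachable)

/-- The first edge of the path from `c` to `b` separates the two. -/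
theorem exists_adj_not_reachable (hT : T.IsTree) {c b : W} (hb : b ≠ c) :
    ∃ x, T.Adj c x ∧ ¬ (T.deleteEdges {s(c, x)}).Reachable c b := by
  obtain ⟨p, hp, -⟩ := hT.existsUnique_path c b
  cases p with
  | nil => exact absurd rfl hb
  | @cons _ x _ h q =>
    refine ⟨x, h, ?_⟩
    have : s(c, x) ∈ cut T c b := by
      rw [← edgeSet_eq_cut hT hp]; simp
    exact this

end Cut

/-! ### Representations through the end vertices of the paths -/

/-- A Helly EPT representation recorded by the end vertices of its paths. -/
structure CutRep {V W : Type*} (G : SimpleGraph V) (T : SimpleGraph W) where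
  src : V → W
  tgt : V → W
  adj_iff : ∀ v w, G.Adj v w ↔ v ≠ w ∧ (cut T (src v) (tgt v) ∩ cut T (src w) (tgt w)).Nonempty
  helly : HellyProperty (fun v => cut T (src v) (tgt v))

namespace CutRep

variable {V W : Type*} {G : SimpleGraph V} {T : SimpleGraph W}

/-- The edge set of the path of `v`. -/
def edges (R : CutRep G T) (v : V) : Set (Sym2 W) := cut T (R.src v) (R.tgt v)

/-- The representation by end vertices underlying a Helly family of paths. -/
def ofPathRep (hT : T.IsTree) (R : PathRep G T)
    (hR : HellyProperty (fun v => (R.path v).edgeSet)) : CutRep G T where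
  src := R.src
  tgt := R.tgt
  adj_iff v w := by
    rw [← edgeSet_eq_cut hT (R.isPath v), ← edgeSet_eq_cut hT (R.isPath w)]
    exact R.adj_iff v w
  helly := by
    simpa only [edgeSet_eq_cut hT (R.isPath _)] using hR

theorem exists_pathRep (hT : T.IsTree) (R : CutRep G T) :
    ∃ R' : PathRep G T, HellyProperty (fun v => (R'.path v).edgeSet) := by
  choose p hp _ using fun v => hT.existsUnique_path (R.src v) (R.tgt v)
  refine ⟨⟨R.src, R.tgt, p, hp, fun v w => ?_⟩, ?_⟩
  · rw [edgeSet_eq_cut hT (hp v), edgeSet_eq_cut hT (hp w)]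
    exact R.adj_iff v w
  · simpa only [edgeSet_eq_cut hT (hp _)] using R.helly

variable (R : CutRep G T)

theorem adj_of_mem {v w : V} {e : Sym2 W} (hne : v ≠ w) (hv : e ∈ R.edges v)
    (hw : e ∈ R.edges w) : G.Adj v w :=
  (R.adj_iff v w).2 ⟨hne, e, hv, hw⟩

theorem exists_mem_of_adj {v w : V} (h : G.Adj v w) : ∃ e, e ∈ R.edges v ∧ e ∈ R.edges w :=
  ((R.adj_iff v w).1 h).2

theorem isClique_of_mem {S : Set V} {e : Sym2 W} (h : ∀ v ∈ S, e ∈ R.edges v) : G.IsClique S :=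
  fun v hv w hw hne => R.adj_of_mem hne (h v hv) (h w hw)

/-- This is how the Helly property locates a clique at one edge of the host tree. -/
theorem exists_common_edge {S : Set V} (hS : G.IsClique S) (hne : S.Nonempty) :
    ∃ e, ∀ v ∈ S, e ∈ R.edges v := by
  obtain ⟨e, he⟩ := R.helly S hne fun v hv w hw hvw => ((R.adj_iff v w).1 (hS hv hw hvw)).2
  exact ⟨e, fun v hv => Set.mem_iInter₂.1 he v hv⟩

end CutRep

/-! ### Maximal cliques -/

theorem exists_isMaxClique_superset {V : Type*} [Finite V] {G : SimpleGraph V} {A S : Set V}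
    (hSA : S ⊆ A) (hS : G.IsClique S) : ∃ C, S ⊆ C ∧ IsMaxClique G A C :=
  (Set.toFinite {S : Set V | S ⊆ A ∧ G.IsClique S}).exists_le_maximal ⟨hSA, hS⟩

theorem IsMaxClique.nonempty {V : Type*} {G : SimpleGraph V} {A C : Set V}
    (hC : IsMaxClique G A C) (hA : A.Nonempty) : C.Nonempty := by
  by_contra hne
  rw [Set.not_nonempty_iff_eq_empty] at hne
  obtain ⟨x, hx⟩ := hA
  have := hC.2 (y := {x}) ⟨by simpa using hx, by simp⟩ (by simp [hne]) rfl
  simp [hne] at this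

theorem IsMaxClique.exists_mem_notMem {V : Type*} {G : SimpleGraph V} {A C D : Set V}
    (hC : IsMaxClique G A C) (hD : IsMaxClique G A D) (hne : D ≠ C) : ∃ v ∈ D, v ∉ C := by
  by_contra h
  push Not at h
  exact hne (hD.eq_of_subset hC.prop h)

/-! ### Atoms have few cliques -/

/-- Every choice of one end of each edge of a finite tree has a sink. -/
theorem exists_sink {W : Type*} [Finite W] {T : SimpleGraph W} (hT : T.IsTree)
    (head : Sym2 W → W) : ∃ c, ∀ x, T.Adj c x → head s(c, x) ∈ s(c, x) → head s(c, x) = c := by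
  classical
  have := Fintype.ofFinite W
  by_contra! hcon
  choose x hx hmem hne using hcon
  have hhead : ∀ c, head s(c, x c) = x c := fun c =>
    (Sym2.mem_iff.1 (hmem c)).resolve_left (hne c)
  -- Without a sink every vertex has an outgoing edge. An edge has only one head, so these edges are
  -- distinct, and a tree has too few of them.
  have hinj : Set.InjOn (fun c => s(c, x c)) (Finset.univ : Finset W) := by
    intro c _ d _ hcd
    have hxx : x c = x d := by
      rw [← hhead c, ← hhead d]; exact congrArg head hcd
    have hcd' : s(c, x c) = s(d, x d) := hcd
    rw [hxx] at hcd'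
    exact Sym2.congr_left.1 hcd'
  have hle := Finset.card_le_card_of_injOn (s := Finset.univ) (t := T.edgeFinset)
    (fun c => s(c, x c)) (fun c _ => by simpa using hx c) hinj
  have := hT.card_edgeFinset
  rw [Finset.card_univ] at hle
  omega

section Atoms

variable {V W : Type*} {G : SimpleGraph V} {T : SimpleGraph W}

/-- Vertices connected by paths avoiding `f` have their paths on one side of `f`. -/
theorem CutRep.reachable_src_of_reachable (R : CutRep G T) {B : Set V} {f : Sym2 W}
    (hB : ∀ v ∈ B, f ∉ R.edges v) {v w : B} (h : (G.induce B).Reachable v w) :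
    (T.deleteEdges {f}).Reachable (R.src v) (R.src w) := by
  obtain ⟨p⟩ := h
  induction p with
  | nil => exact .refl _
  | @cons u v w huv p ih =>
    -- Both paths contain `e` and avoid `f`, so an end of `e` is on the side of both sources.
    obtain ⟨e, hu, hv⟩ := R.exists_mem_of_adj huv
    refine Reachable.trans ?_ ih
    induction e with | _ x y =>
    exact (reachable_of_mem_cut hu (Sym2.mem_mk_left x y) (hB u u.2)).trans
      (reachable_of_mem_cut hv (Sym2.mem_mk_left x y) (hB v v.2)).symm

/-- All but one of the cliques of an atom lie on one side of a given edge of the host tree. -/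
theorem exists_side [Finite V] (hT : T.IsTree) (R : CutRep G T) {A : Set V} (hA : IsAtomSet G A)
    (e : Set V → Sym2 W) (he : ∀ D, IsMaxClique G A D → ∀ v ∈ D, e D ∈ R.edges v) (f : Sym2 W) :
    ∃ r ∈ f, ∃ C, ∀ D, IsMaxClique G A D → D ≠ C →
      ∀ x ∈ e D, (T.deleteEdges {f}).Reachable r x := by
  -- The exceptional clique absorbs every vertex of `A` whose path uses `f`; what remains is
  -- connected because `A` is an atom.
  obtain ⟨C, hfC, hC⟩ := exists_isMaxClique_superset (G := G) (A := A)
    (S := {v | v ∈ A ∧ f ∈ R.edges v}) (fun v hv => hv.1) (R.isClique_of_mem fun v hv => hv.2)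
  have hav : ∀ v ∈ A \ C, f ∉ R.edges v := fun v hv hf => hv.2 (hfC ⟨hv.1, hf⟩)
  have hpre : (G.induce (A \ C)).Preconnected := by
    by_contra h
    exact hA.2 C ⟨hA.1, hC, h⟩
  obtain ⟨r, hr, hrv⟩ : ∃ r ∈ f, ∀ v ∈ A \ C, (T.deleteEdges {f}).Reachable r (R.src v) := by
    induction f with | _ p q =>
    rcases (A \ C).eq_empty_or_nonempty with h | ⟨w, hw⟩
    · exact ⟨p, by simp, by simp [h]⟩
    have key : ∀ v ∈ A \ C, (T.deleteEdges {s(p, q)}).Reachable (R.src w) (R.src v) :=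
      fun v hv => R.reachable_src_of_reachable hav (hpre ⟨w, hw⟩ ⟨v, hv⟩)
    rcases reachable_end hT.connected p q (R.src w) with h | h
    · exact ⟨p, by simp, fun v hv => h.trans (key v hv)⟩
    · exact ⟨q, by simp, fun v hv => h.trans (key v hv)⟩
  refine ⟨r, hr, C, fun D hD hne x hx => ?_⟩
  obtain ⟨v, hvD, hvC⟩ := hC.exists_mem_notMem hD hne
  have hv : v ∈ A \ C := ⟨hD.prop.1 hvD, hvC⟩
  exact (hrv v hv).trans (reachable_of_mem_cut (he D hD v hvD) hx (hav v hv))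

/-- An atom has at most as many cliques as the maximum degree of a host tree. -/
theorem ncard_isMaxClique_le [Finite V] [Fintype W] [DecidableRel T.Adj] (hT : T.IsTree)
    (R : CutRep G T) {A : Set V} (hA : IsAtomSet G A) :
    {C : Set V | IsMaxClique G A C}.ncard ≤ T.maxDegree := by
  classical
  obtain ⟨⟨a, ha⟩⟩ := hA.1.nonempty
  have hex : ∀ D, ∃ e, IsMaxClique G A D → ∀ v ∈ D, e ∈ R.edges v := by
    intro D
    by_cases hD : IsMaxClique G A D
    · obtain ⟨e, he⟩ := R.exists_common_edge hD.prop.2 (hD.nonempty ⟨a, ha⟩)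
      exact ⟨e, fun _ => he⟩
    -- Arbitrary value for sets that are not cliques of the atom.
    · exact ⟨s(R.src a, R.src a), fun h => absurd h hD⟩
  choose e he using hex
  choose head hhead Cx hCx using exists_side hT R hA e he
  obtain ⟨c, hc⟩ := exists_sink hT head
  have hex : ∀ D, ∃ x, IsMaxClique G A D → T.Adj c x ∧
      ∃ b ∈ e D, ¬ (T.deleteEdges {s(c, x)}).Reachable c b := by
    intro D
    by_cases hD : IsMaxClique G A D
    · obtain ⟨v, hv⟩ := hD.nonempty ⟨a, ha⟩
      have hmem : e D ∈ T.edgeSet := cut_subset_edgeSet hT.connected (he D hD v hv)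
      obtain ⟨b, hb, hbc⟩ := exists_mem_ne hmem c
      obtain ⟨x, hx, hxb⟩ := exists_adj_not_reachable hT hbc
      exact ⟨x, fun _ => ⟨hx, b, hb, hxb⟩⟩
    · exact ⟨c, fun h => absurd h hD⟩
  choose x hx using hex
  refine le_trans ?_ (T.degree_le_maxDegree c)
  rw [← card_neighborFinset_eq_degree, ← Set.ncard_coe_finset]
  refine Set.ncard_le_ncard_of_injOn x (fun D hD => by simpa using (hx D hD).1) ?_
    (Set.toFinite _)
  -- As `c` is a sink, only the exceptional clique of the edge from `c` to `x D` can have an end of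
  -- its host edge beyond that edge.
  have huniq : ∀ D, IsMaxClique G A D → D = Cx s(c, x D) := by
    intro D hD
    obtain ⟨hadj, b, hb, hnb⟩ := hx D hD
    by_contra hne
    have := hCx s(c, x D) D hD hne b hb
    rw [hc _ hadj (hhead _)] at this
    exact hnb this
  intro D hD D' hD' hxx
  rw [huniq D hD, huniq D' hD', hxx]

end Atoms

theorem CliqueDecompTree.isAtomSet_of_mem_atoms {V : Type*} {G : SimpleGraph V} {A : Set V}
    (t : CliqueDecompTree G A) {B : Set V} (hB : B ∈ t.atoms) : IsAtomSet G B := by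
  induction t with
  | leaf A hA => rw [CliqueDecompTree.atoms, Set.mem_singleton_iff] at hB; exact hB ▸ hA
  | node A C hC child ih =>
    rw [CliqueDecompTree.atoms, Set.mem_iUnion] at hB
    obtain ⟨K, hK⟩ := hB
    exact ih K hK

/-! ### Vertices of the host tree with connected links -/

namespace CutRep

variable {V W : Type*} {G : SimpleGraph V} {T : SimpleGraph W} (R : CutRep G T)

/-- The graph on the neighbours of `c` other than `x` in which two of them are adjacent if some
path avoiding the edge `cx` passes through both. -/
def link (c x : W) : SimpleGraph {y // T.Adj c y ∧ y ≠ x} where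
  Adj y z := y ≠ z ∧
    ∃ v, s(c, x) ∉ R.edges v ∧ s(c, y.1) ∈ R.edges v ∧ s(c, z.1) ∈ R.edges v
  symm := ⟨fun _ _ ⟨h, v, hx, hy, hz⟩ => ⟨h.symm, v, hx, hz, hy⟩⟩
  loopless := ⟨fun _ h => h.1 rfl⟩

/-- The vertices whose paths have `c` as an inner vertex. -/
def through (c : W) : Set V :=
  {v | ∃ y z, y ≠ z ∧ s(c, y) ∈ R.edges v ∧ s(c, z) ∈ R.edges v}

variable {R}

theorem exists_mem_of_mem_through (hT : T.IsTree) {c : W} {v : V} (hv : v ∈ R.through c) (x : W) :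
    ∃ y : {y // T.Adj c y ∧ y ≠ x}, s(c, y.1) ∈ R.edges v := by
  obtain ⟨y, z, hyz, hy, hz⟩ := hv
  by_cases h : y = x
  · exact ⟨⟨z, cut_subset_edgeSet hT.connected hz, fun hzx => hyz (h.trans hzx.symm)⟩, hz⟩
  · exact ⟨⟨y, cut_subset_edgeSet hT.connected hy, h⟩, hy⟩

/-- If the link is connected, deleting vertices whose paths contain `cx` does not disconnect the
set of vertices whose paths pass through `c`. -/
theorem reachable_of_mem_through (hT : T.IsTree) {c x : W} (hx : (R.link c x).Preconnected)
    {A Z : Set V} (hA : R.through c ⊆ A) (hZ : ∀ v ∈ R.through c, v ∈ Z → s(c, x) ∈ R.edges v)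
    {v w : V} (hv : v ∈ R.through c) (hvZ : v ∉ Z) (hw : w ∈ R.through c) (hwZ : w ∉ Z) :
    (G.induce (A \ Z)).Reachable ⟨v, hA hv, hvZ⟩ ⟨w, hA hw, hwZ⟩ := by
  have hadj : ∀ (v w : V) (hv : v ∈ R.through c) (hvZ : v ∉ Z) (hw : w ∈ R.through c)
      (hwZ : w ∉ Z) (e : Sym2 W), e ∈ R.edges v → e ∈ R.edges w →
      (G.induce (A \ Z)).Reachable ⟨v, hA hv, hvZ⟩ ⟨w, hA hw, hwZ⟩ := by
    intro v w hv hvZ hw hwZ e hev hew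
    by_cases hvw : v = w
    · subst hvw; exact .refl _
    · exact Adj.reachable (show G.Adj v w from R.adj_of_mem hvw hev hew)
  obtain ⟨y, hy⟩ := exists_mem_of_mem_through hT hv x
  obtain ⟨z, hz⟩ := exists_mem_of_mem_through hT hw x
  obtain ⟨p⟩ := hx y z
  induction p generalizing v with
  | nil => exact hadj v w hv hvZ hw hwZ _ hy hz
  | @cons a b _ hab p ih =>
    -- The path witnessing a link edge passes through `c` and avoids `cx`, so its vertex `u`
    -- survives the deletion of `Z`. Walks in the link thus become walks in the graph.
    obtain ⟨hne, u, hux, hua, hub⟩ := hab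
    have hu : u ∈ R.through c := ⟨a, b, fun h => hne (Subtype.ext h), hua, hub⟩
    have huZ : u ∉ Z := fun h => hux (hZ u hu h)
    exact (hadj v u hv hvZ hu huZ _ hy hua).trans (ih hu huZ hub hz)

/-- Every edge lies in the branch of some neighbour of `c`. -/
theorem exists_branch (hT : T.IsTree) (c : W) {e : Sym2 W} (he : e ∈ T.edgeSet) :
    ∃ x, T.Adj c x ∧
      ∀ v ∈ R.through c, e ∈ R.edges v → s(c, x) ∈ R.edges v := by
  obtain ⟨b, hb, hbc⟩ := exists_mem_ne he c
  obtain ⟨x, hx, hxb⟩ := exists_adj_not_reachable hT hbc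
  refine ⟨x, hx, fun v ⟨y, _, _, hy, _⟩ hev => ?_⟩
  -- A path through `c` that contains `e` but avoids `cx` would connect `c` to `b` without `cx`.
  by_contra hxv
  exact hxb ((reachable_of_mem_cut hy (Sym2.mem_mk_left c y) hxv).symm.trans
    (reachable_of_mem_cut hev hb hxv))

/-- The common host edge of the clique lies in one branch at `c`, and paths from `c` into that
branch enter it by its first edge. -/
theorem _root_.HellyEPT.IsMaxClique.exists_branch (hT : T.IsTree) (c : W) {A C : Set V}
    (hA : A.Nonempty) (hC : IsMaxClique G A C) :
    ∃ x, T.Adj c x ∧ ∀ v ∈ R.through c, v ∈ C → s(c, x) ∈ R.edges v := by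
  obtain ⟨w, hw⟩ := hC.nonempty hA
  obtain ⟨e, he⟩ := R.exists_common_edge hC.prop.2 ⟨w, hw⟩
  obtain ⟨x, hx, hxv⟩ := CutRep.exists_branch (R := R) hT c
    (cut_subset_edgeSet hT.connected (he w hw))
  exact ⟨x, hx, fun v hv hvC => hxv v hv (he v hvC)⟩

/-- With connected links, some atom contains all vertices whose paths pass through `c`. -/
theorem exists_atom_superset (hT : T.IsTree) {c : W}
    (hc : ∀ x, T.Adj c x → (R.link c x).Preconnected) {A : Set V} (t : CliqueDecompTree G A)
    (hA : R.through c ⊆ A) : ∃ B ∈ t.atoms, R.through c ⊆ B := by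
  induction t with
  | leaf A _ => exact ⟨A, rfl, hA⟩
  | node A C hC child ih =>
    obtain ⟨⟨a, ha⟩⟩ := hC.1.nonempty
    obtain ⟨x, hx, hxC⟩ := hC.2.1.exists_branch (R := R) hT c ⟨a, ha⟩
    obtain ⟨K, hK⟩ : ∃ K : (G.induce (A \ C)).ConnectedComponent,
        R.through c ⊆ C ∪ Subtype.val '' K.supp := by
      by_cases hsub : R.through c ⊆ C
      -- Any component will do here; one exists because `A \ C` is not preconnected.
      · obtain ⟨y, -⟩ := not_forall.1 hC.2.2
        exact ⟨connectedComponentMk _ y, fun v hv => Or.inl (hsub hv)⟩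
      · obtain ⟨v, hv, hvC⟩ := Set.not_subset.1 hsub
        refine ⟨connectedComponentMk _ ⟨v, hA hv, hvC⟩, fun w hw => ?_⟩
        by_cases hwC : w ∈ C
        · exact Or.inl hwC
        · exact Or.inr ⟨⟨w, hA hw, hwC⟩, ConnectedComponent.sound
            (reachable_of_mem_through hT (hc x hx) hA hxC hw hwC hv hvC), rfl⟩
    obtain ⟨B, hB, hBt⟩ := ih K hK
    exact ⟨B, by rw [CliqueDecompTree.atoms]; exact Set.mem_iUnion.2 ⟨K, hB⟩, hBt⟩

/-- With connected links, no two neighbours of `c` lie on the same paths. -/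
theorem exists_mem_notMem_of_link [Fintype W] [DecidableRel T.Adj] {c : W} (hdeg : 3 ≤ T.degree c)
    {x b : W} (hc : (R.link c b).Preconnected) (hx : T.Adj c x) (hxb : x ≠ b) :
    ∃ v ∈ R.through c, s(c, x) ∈ R.edges v ∧ s(c, b) ∉ R.edges v := by
  classical
  -- A third neighbour gives the link of `b` a vertex other than `x`; the first edge of a walk from
  -- `x` to it yields the path sought.
  obtain ⟨z, hz, hzx⟩ : ∃ z ∈ T.neighborFinset c, z ∉ ({x, b} : Finset W) :=
    Finset.exists_mem_notMem_of_card_lt_card (Finset.card_le_two.trans_lt hdeg)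
  simp only [Finset.mem_insert, Finset.mem_singleton, not_or] at hzx
  rw [mem_neighborFinset] at hz
  obtain ⟨p⟩ := hc ⟨x, hx, hxb⟩ ⟨z, hz, hzx.2⟩
  cases p with
  | nil => exact absurd rfl hzx.1
  | @cons _ y _ hy _ =>
    obtain ⟨hne, v, hvb, hvx, hvy⟩ := hy
    exact ⟨v, ⟨x, y, fun h => hne (Subtype.ext h), hvx, hvy⟩, hvx, hvb⟩

/-- With connected links at `c`, an induced subgraph containing all vertices whose paths pass
through `c` has at least as many cliques as `c` has neighbours. -/
theorem degree_le_ncard_isMaxClique [Finite V] [Fintype W] [DecidableRel T.Adj] (hT : T.IsTree)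
    {c : W} (hdeg : 3 ≤ T.degree c) (hc : ∀ x, T.Adj c x → (R.link c x).Preconnected)
    {A : Set V} (hA : R.through c ⊆ A) :
    T.degree c ≤ {C : Set V | IsMaxClique G A C}.ncard := by
  classical
  obtain ⟨x₀, hx₀, b₀, hb₀, hne₀⟩ := Finset.one_lt_card.1
    (show 1 < (T.neighborFinset c).card from lt_of_lt_of_le (by norm_num) hdeg)
  rw [mem_neighborFinset] at hx₀ hb₀
  obtain ⟨a, ha, -⟩ := exists_mem_notMem_of_link hdeg (hc b₀ hb₀) hx₀ hne₀
  have hAne : A.Nonempty := ⟨a, hA ha⟩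
  have hex : ∀ x, ∃ C, {v | v ∈ R.through c ∧ s(c, x) ∈ R.edges v} ⊆ C ∧ IsMaxClique G A C :=
    fun x => exists_isMaxClique_superset (fun v hv => hA hv.1) (R.isClique_of_mem fun v hv => hv.2)
  choose C hsub hC using hex
  rw [← card_neighborFinset_eq_degree, ← Set.ncard_coe_finset]
  refine Set.ncard_le_ncard_of_injOn C (fun x _ => hC x) ?_ (Set.toFinite _)
  intro x hx y hy hxy
  rw [Finset.mem_coe, mem_neighborFinset] at hx hy
  by_contra hne
  obtain ⟨b, hb, hbv⟩ := (hC x).exists_branch (R := R) hT c hAne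
  -- All paths through `c` in the clique `C x` use `cb`, whereas for `z ≠ b` some path in `C z`
  -- passes through `c` using `cz` and not `cb`.
  have key : ∀ z, T.Adj c z → C z = C x → z = b := by
    intro z hz hzx
    by_contra hzb
    obtain ⟨v, hv, hvz, hvb⟩ := exists_mem_notMem_of_link hdeg (hc b hb) hz hzb
    exact hvb (hbv v hv (hzx ▸ hsub z ⟨hv, hvz⟩))
  exact hne ((key x hx rfl).trans (key y hy hxy.symm).symm)

/-- With connected links at `c`, some atom has at least as many cliques as `c` has neighbours. -/
theorem exists_atom_degree_le [Finite V] [Fintype W] [DecidableRel T.Adj] (hT : T.IsTree)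
    (R : CutRep G T) {c : W} (hdeg : 3 ≤ T.degree c)
    (hc : ∀ x, T.Adj c x → (R.link c x).Preconnected)
    (D : ∀ K : G.ConnectedComponent, CliqueDecompTree G K.supp) :
    ∃ K, ∃ A ∈ (D K).atoms, T.degree c ≤ {C : Set V | IsMaxClique G A C}.ncard := by
  classical
  obtain ⟨x, hx, b, hb, hne⟩ := Finset.one_lt_card.1
    (show 1 < (T.neighborFinset c).card from lt_of_lt_of_le (by norm_num) hdeg)
  rw [mem_neighborFinset] at hx hb
  obtain ⟨a, ha, -⟩ := exists_mem_notMem_of_link hdeg (hc b hb) hx hne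
  have hsub : R.through c ⊆ (G.connectedComponentMk a).supp := by
    intro v hv
    -- With nothing deleted, this puts all paths through `c` in one component of `G`.
    have := reachable_of_mem_through hT (hc x hx) (Set.subset_univ _) (Z := ∅)
      (fun _ _ h => absurd h (Set.notMem_empty _)) hv (Set.notMem_empty _) ha (Set.notMem_empty _)
    exact ConnectedComponent.sound (this.map (Embedding.induce _).toHom)
  obtain ⟨A, hA, hsubA⟩ := exists_atom_superset hT hc (D (G.connectedComponentMk a)) hsub
  exact ⟨_, A, hA, degree_le_ncard_isMaxClique hT hdeg hc hsubA⟩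

end CutRep

/-! ### Splitting a vertex of the host tree -/

section Split

variable {W : Type*} (T : SimpleGraph W) (c : W) (N : Set W)

/-- The graph obtained from `T` by splitting `c` into two adjacent vertices `some c` and `none`, the
neighbours of `c` that lie in `N` being attached to `none`. -/
def split : SimpleGraph (Option W) where
  Adj
    | some a, some b => T.Adj a b ∧ ¬ (a = c ∧ b ∈ N) ∧ ¬ (b = c ∧ a ∈ N)
    | none, some b => b = c ∨ T.Adj c b ∧ b ∈ N
    | some a, none => a = c ∨ T.Adj c a ∧ a ∈ N
    | none, none => False
  symm := ⟨by
    rintro (_ | a) (_ | b) h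
    · exact h
    · exact h
    · exact h
    · exact ⟨h.1.symm, h.2.2, h.2.1⟩⟩
  loopless := ⟨by
    rintro (_ | a) h
    · exact h
    · exact h.1.ne rfl⟩

/-- The contraction of the new edge of `split T c N`. -/
def merge : Option W → W := fun a => a.getD c

/-- The new edge of `split T c N`. -/
def splitEdge : Sym2 (Option W) := s(none, some c)

variable {T c N}

@[simp] theorem merge_none : merge c none = c := rfl

@[simp] theorem merge_some (a : W) : merge c (some a) = a := rfl

theorem split_adj_some_some {a b : W} : (split T c N).Adj (some a) (some b) ↔
    T.Adj a b ∧ ¬ (a = c ∧ b ∈ N) ∧ ¬ (b = c ∧ a ∈ N) := Iff.rfl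

theorem split_adj_none_some {b : W} : (split T c N).Adj none (some b) ↔
    b = c ∨ T.Adj c b ∧ b ∈ N := Iff.rfl

theorem split_adj_some_none {a : W} : (split T c N).Adj (some a) none ↔
    a = c ∨ T.Adj c a ∧ a ∈ N := Iff.rfl

theorem split_adj_splitEdge : (split T c N).Adj none (some c) := Or.inl rfl

theorem adj_merge_of_split_adj {a b : Option W} (h : (split T c N).Adj a b)
    (hf : s(a, b) ≠ splitEdge c) : T.Adj (merge c a) (merge c b) := by
  rcases a with _ | a <;> rcases b with _ | b
  · exact h.elim
  · rcases h with rfl | h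
    · exact absurd rfl hf
    · exact h.1
  · rcases h with rfl | h
    · exact absurd Sym2.eq_swap hf
    · exact h.1.symm
  · exact h.1

/-- Only the two vertices over `c` are identified, and whether the other end lies in `N` tells which
of them an old edge uses. -/
theorem eq_of_merge_eq {a b a' b' : Option W} (h : (split T c N).Adj a b)
    (h' : (split T c N).Adj a' b') (hf : s(a, b) ≠ splitEdge c) (hf' : s(a', b') ≠ splitEdge c)
    (ha : merge c a = merge c a') (hb : merge c b = merge c b') : a = a' ∧ b = b' := by
  have hadj := adj_merge_of_split_adj h hf
  have hne := hadj.ne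
  rcases a with _ | a <;> rcases b with _ | b <;> rcases a' with _ | a' <;> rcases b' with _ | b' <;>
    simp_all [split_adj_some_some, split_adj_none_some, split_adj_some_none]

theorem merge_injOn : Set.InjOn (Sym2.map (merge c)) ((split T c N).edgeSet \ {splitEdge c}) := by
  rintro e ⟨he, hef⟩ e' ⟨he', hef'⟩ heq
  induction e with | _ a b =>
  induction e' with | _ a' b' =>
  rw [Sym2.map_mk, Sym2.map_mk] at heq
  rcases Sym2.eq_iff.1 heq with ⟨h₁, h₂⟩ | ⟨h₁, h₂⟩
  · obtain ⟨rfl, rfl⟩ := eq_of_merge_eq he he' hef hef' h₁ h₂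
    rfl
  · rw [Set.mem_singleton_iff, Sym2.eq_swap] at hef'
    obtain ⟨rfl, rfl⟩ := eq_of_merge_eq he (Adj.symm he') hef hef' h₁ h₂
    exact Sym2.eq_swap

theorem map_merge_mem_edgeSet {e : Sym2 (Option W)} (he : e ∈ (split T c N).edgeSet)
    (hf : e ≠ splitEdge c) : Sym2.map (merge c) e ∈ T.edgeSet := by
  induction e with | _ a b =>
  exact adj_merge_of_split_adj he hf

theorem exists_lift_adj {a b : W} (h : T.Adj a b) : ∃ a' b', merge c a' = a ∧ merge c b' = b ∧
    (split T c N).Adj a' b' ∧ s(a', b') ≠ splitEdge c := by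
  by_cases h₁ : a = c ∧ b ∈ N
  · obtain ⟨rfl, hb⟩ := h₁
    exact ⟨none, some b, rfl, rfl, Or.inr ⟨h, hb⟩, by simp [splitEdge, h.ne']⟩
  by_cases h₂ : b = c ∧ a ∈ N
  · obtain ⟨rfl, ha⟩ := h₂
    exact ⟨some a, none, rfl, rfl, Or.inr ⟨h.symm, ha⟩, by simp [splitEdge, h.ne]⟩
  exact ⟨some a, some b, rfl, rfl, ⟨h, h₁, h₂⟩, by simp [splitEdge]⟩

theorem exists_lift_edge {e : Sym2 W} (he : e ∈ T.edgeSet) :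
    ∃ e' ∈ (split T c N).edgeSet, e' ≠ splitEdge c ∧ Sym2.map (merge c) e' = e := by
  induction e with | _ a b =>
  obtain ⟨a', b', rfl, rfl, hadj, hf⟩ := exists_lift_adj (c := c) (N := N) he
  exact ⟨s(a', b'), hadj, hf, rfl⟩

/-- Reachability lifts along the contraction of the new edge. -/
theorem reachable_of_reachable_merge {H : SimpleGraph W} {H' : SimpleGraph (Option W)}
    (hf : H'.Adj none (some c))
    (hlift : ∀ a b, H.Adj a b → ∃ a' b', merge c a' = a ∧ merge c b' = b ∧ H'.Adj a' b')
    {a b : Option W} (h : H.Reachable (merge c a) (merge c b)) : H'.Reachable a b := by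
  have hfib : ∀ a b, merge c a = merge c b → H'.Reachable a b := by
    rintro (_ | a) (_ | b) hab
    · exact .refl _
    · obtain rfl : c = b := hab
      exact hf.reachable
    · obtain rfl : a = c := hab
      exact hf.reachable.symm
    · obtain rfl : a = b := hab
      exact .refl _
  obtain ⟨p⟩ := h
  suffices key : ∀ (x y : W) (_ : H.Walk x y) (a b : Option W), merge c a = x → merge c b = y →
      H'.Reachable a b from key _ _ p a b rfl rfl
  intro x y p
  induction p with
  | nil => exact fun a b ha hb => hfib a b (ha.trans hb.symm)
  | cons hxy p ih =>
    intro a b ha hb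
    obtain ⟨a', b', ha', hb', hadj⟩ := hlift _ _ hxy
    exact ((hfib a a' (ha.trans ha'.symm)).trans hadj.reachable).trans (ih b' b hb' hb)

/-- Deleting an old edge keeps the new one, so contracting the new edge does not change which
vertices are connected. Hence old edges separate the same vertices before and after the splitting.
-/
theorem reachable_split_deleteEdges_iff {e : Sym2 (Option W)} (he : e ∈ (split T c N).edgeSet)
    (hf : e ≠ splitEdge c) {a b : Option W} :
    ((split T c N).deleteEdges {e}).Reachable a b ↔
      (T.deleteEdges {Sym2.map (merge c) e}).Reachable (merge c a) (merge c b) := by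
  constructor
  · rintro ⟨p⟩
    induction p with
    | nil => exact .refl _
    | @cons a b _ hab p ih =>
      refine Reachable.trans ?_ ih
      rw [deleteEdges_adj] at hab
      by_cases habf : s(a, b) = splitEdge c
      · have : merge c a = merge c b := by
          rcases Sym2.eq_iff.1 habf with ⟨rfl, rfl⟩ | ⟨rfl, rfl⟩ <;> rfl
        rw [this]
      · refine Adj.reachable (deleteEdges_adj.2 ⟨adj_merge_of_split_adj hab.1 habf, fun h => ?_⟩)
        exact hab.2 (merge_injOn ⟨hab.1, habf⟩ ⟨he, hf⟩ h)
  · refine reachable_of_reachable_merge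
      (deleteEdges_adj.2 ⟨split_adj_splitEdge, fun h => hf h.symm⟩) fun a b hab => ?_
    rw [deleteEdges_adj] at hab
    obtain ⟨a', b', rfl, rfl, hadj, -⟩ := exists_lift_adj (c := c) (N := N) hab.1
    exact ⟨a', b', rfl, rfl, deleteEdges_adj.2 ⟨hadj, fun h => hab.2 (by
      rw [Set.mem_singleton_iff] at h; rw [← h]; rfl)⟩⟩

theorem mem_cut_split_iff {e : Sym2 (Option W)} (he : e ∈ (split T c N).edgeSet)
    (hf : e ≠ splitEdge c) {a b : Option W} :
    e ∈ cut (split T c N) a b ↔ Sym2.map (merge c) e ∈ cut T (merge c a) (merge c b) :=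
  not_congr (reachable_split_deleteEdges_iff he hf)

/-- Connectedness lifts along the contraction, and the one new vertex comes with at most one
additional edge. -/
theorem isTree_split [Finite W] (hT : T.IsTree) : (split T c N).IsTree := by
  have hconn : (split T c N).Connected := by
    refine ⟨fun a b => reachable_of_reachable_merge split_adj_splitEdge (fun a b hab => ?_)
      (hT.connected.preconnected (merge c a) (merge c b))⟩
    obtain ⟨a', b', ha, hb, hadj, -⟩ := exists_lift_adj (c := c) (N := N) hab
    exact ⟨a', b', ha, hb, hadj⟩
  refine isTree_iff_connected_and_card.2 ⟨hconn, le_antisymm ?_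
    hconn.card_vert_le_card_edgeSet_add_one⟩
  have h₁ := (isTree_iff_connected_and_card.1 hT).2
  have h₂ : ((split T c N).edgeSet \ {splitEdge c}).ncard ≤ T.edgeSet.ncard :=
    Set.ncard_le_ncard_of_injOn _ (fun e he => map_merge_mem_edgeSet he.1 he.2) merge_injOn
      (Set.toFinite _)
  have h₃ := Set.ncard_sdiff_singleton_add_one
    (show splitEdge c ∈ (split T c N).edgeSet from split_adj_splitEdge) (Set.toFinite _)
  have h₄ : Nat.card (Option W) = Nat.card W + 1 := Finite.card_option
  rw [Nat.card_coe_set_eq] at h₁ ⊢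
  omega

theorem ncard_neighborSet_split_some [Finite W] {w : W} (hw : w ≠ c) :
    ((split T c N).neighborSet (some w)).ncard ≤ (T.neighborSet w).ncard := by
  have hne : ∀ a : Option W, s(some w, a) ≠ splitEdge c := by
    intro a h
    rcases Sym2.eq_iff.1 h with ⟨h, -⟩ | ⟨h, -⟩
    · cases h
    · exact hw (Option.some.inj h)
  refine Set.ncard_le_ncard_of_injOn (merge c)
    (fun a ha => adj_merge_of_split_adj ha (hne a)) (fun a ha b hb hab => ?_) (Set.toFinite _)
  exact (eq_of_merge_eq ha hb (hne a) (hne b) rfl hab).2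

theorem ncard_neighborSet_split_some_self [Finite W] :
    ((split T c N).neighborSet (some c)).ncard ≤ (T.neighborSet c \ N).ncard + 1 := by
  rw [← Set.ncard_image_of_injective (T.neighborSet c \ N) (Option.some_injective W)]
  refine le_trans (Set.ncard_le_ncard (t := insert none _) ?_ (Set.toFinite _))
    (Set.ncard_insert_le _ _)
  rintro (_ | a) ha
  · exact Set.mem_insert _ _
  · exact Or.inr ⟨a, ⟨ha.1, fun h => ha.2.1 ⟨rfl, h⟩⟩, rfl⟩

theorem ncard_neighborSet_split_none [Finite W] :
    ((split T c N).neighborSet none).ncard ≤ (T.neighborSet c ∩ N).ncard + 1 := by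
  rw [← Set.ncard_image_of_injective (T.neighborSet c ∩ N) (Option.some_injective W)]
  refine le_trans (Set.ncard_le_ncard (t := insert (some c) _) ?_ (Set.toFinite _))
    (Set.ncard_insert_le _ _)
  rintro (_ | a) ha
  · exact ha.elim
  · rcases ha with rfl | ha
    · exact Set.mem_insert _ _
    · exact Or.inr ⟨a, ha, rfl⟩

/-- The total amount by which degrees exceed three. -/
noncomputable def excess {W : Type*} [Fintype W] (T : SimpleGraph W) : ℕ :=
  ∑ w, ((T.neighborSet w).ncard - 3)

/-- With `p, q ≥ 2` neighbours on the two sides, the contribution `p + q - 3` of `c` is replaced by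
at most `(p + 1 - 3) + (q + 1 - 3) = p + q - 4`, and no other degree grows. -/
theorem excess_split_lt [Fintype W] (h₁ : 2 ≤ (T.neighborSet c ∩ N).ncard)
    (h₂ : 2 ≤ (T.neighborSet c \ N).ncard) : excess (split T c N) < excess T := by
  classical
  rw [excess, excess, Fintype.sum_option, ← Finset.add_sum_erase _ _ (Finset.mem_univ c),
    ← Finset.add_sum_erase _ (fun w => (T.neighborSet w).ncard - 3)
      (Finset.mem_univ c)]
  have hsum : ∑ w ∈ Finset.univ.erase c, (((split T c N).neighborSet (some w)).ncard - 3) ≤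
      ∑ w ∈ Finset.univ.erase c, ((T.neighborSet w).ncard - 3) :=
    Finset.sum_le_sum fun w hw =>
      Nat.sub_le_sub_right (ncard_neighborSet_split_some (Finset.ne_of_mem_erase hw)) 3
  have h₃ := ncard_neighborSet_split_some_self (T := T) (c := c) (N := N)
  have h₄ := ncard_neighborSet_split_none (T := T) (c := c) (N := N)
  have h₅ := Set.ncard_inter_add_ncard_sdiff_eq_ncard (T.neighborSet c) N (Set.toFinite _)
  omega

end Split

/-! ### Lifting a representation to the split tree -/

namespace CutRep

variable {V W : Type*} {G : SimpleGraph V} {T : SimpleGraph W}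

open Classical in
/-- The vertex of `split T c N` over `a` at which the path of `v` is continued. -/
noncomputable def splitLift (R : CutRep G T) (c : W) (N : Set W) (v : V) (a : W) : Option W :=
  -- The condition holds vacuously if the path has no edge at `c`; this is harmless, since both ends
  -- of the path are lifted by the same rule.
  if a = c ∧ ∀ y, s(c, y) ∈ R.edges v → y ∈ N then none else some a

@[simp] theorem merge_splitLift (R : CutRep G T) (c : W) (N : Set W) (v : V) (a : W) :
    merge c (R.splitLift c N v a) = a := by
  unfold splitLift
  split_ifs with h
  · exact h.1.symm
  · rfl

theorem splitLift_self (R : CutRep G T) {c : W} {N : Set W} {v : V}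
    (h : ∀ y, s(c, y) ∈ R.edges v → y ∈ N) : R.splitLift c N v c = none :=
  if_pos ⟨rfl, h⟩

theorem splitLift_of_ne (R : CutRep G T) {c : W} {N : Set W} {v : V} {a : W} (h : a ≠ c) :
    R.splitLift c N v a = some a :=
  if_neg fun h' => h h'.1

/-- A path whose edges at `c` are on one side of the splitting lifts to a path that avoids the new
edge. -/
theorem reachable_splitLift (R : CutRep G T) {c : W} {N : Set W} {v : V}
    (hv : (∀ y, s(c, y) ∈ R.edges v → y ∈ N) ∨ ∀ y, s(c, y) ∈ R.edges v → y ∉ N) {a b : W}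
    (p : T.Walk a b) (hp : ∀ e ∈ p.edges, e ∈ R.edges v) :
    ((split T c N).deleteEdges {splitEdge c}).Reachable (R.splitLift c N v a)
      (R.splitLift c N v b) := by
  induction p with
  | nil => exact .refl _
  | @cons a b _ hab p ih =>
    rw [Walk.edges_cons, List.forall_mem_cons] at hp
    refine Reachable.trans (Adj.reachable ?_) (ih hp.2)
    have hmem := hp.1
    have hmem' : s(b, a) ∈ R.edges v := Sym2.eq_swap ▸ hmem
    have hne := hab.ne
    rw [deleteEdges_adj]
    by_cases hN : ∀ y, s(c, y) ∈ R.edges v → y ∈ N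
    · by_cases ha : a = c
      · subst ha
        rw [R.splitLift_self hN, R.splitLift_of_ne hne.symm]
        exact ⟨Or.inr ⟨hab, hN _ hmem⟩, by simp [splitEdge, hne.symm]⟩
      · by_cases hb : b = c
        · subst hb
          rw [R.splitLift_self hN, R.splitLift_of_ne hne]
          exact ⟨Or.inr ⟨hab.symm, hN _ hmem'⟩, by simp [splitEdge, hne]⟩
        · rw [R.splitLift_of_ne ha, R.splitLift_of_ne hb]
          exact ⟨⟨hab, fun h => ha h.1, fun h => hb h.1⟩, by simp [splitEdge]⟩
    · have hN' := hv.resolve_left hN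
      have h₁ : ¬ (a = c ∧ b ∈ N) := by
        rintro ⟨rfl, h⟩; exact hN' _ hmem h
      have h₂ : ¬ (b = c ∧ a ∈ N) := by
        rintro ⟨rfl, h⟩; exact hN' _ hmem' h
      simp only [splitLift, hN, and_false, if_false, split_adj_some_some]
      exact ⟨⟨hab, h₁, h₂⟩, by simp [splitEdge]⟩

/-- A splitting of `c` such that the edges at `c` of every path avoiding `cx` are on one side
preserves the represented graph. -/
theorem exists_split (hT : T.IsTree) (R : CutRep G T) {c x : W} {N : Set W}
    (hN : ∀ v, s(c, x) ∉ R.edges v →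
      (∀ y, s(c, y) ∈ R.edges v → y ∈ N) ∨ ∀ y, s(c, y) ∈ R.edges v → y ∉ N)
    [Finite W] : Nonempty (CutRep G (split T c N)) := by
  have hT' := isTree_split (c := c) (N := N) hT
  let S : V → Set (Sym2 (Option W)) := fun v =>
    cut (split T c N) (R.splitLift c N v (R.src v)) (R.splitLift c N v (R.tgt v))
  -- The crux: paths that share the new edge already shared `cx`, so they intersected before the
  -- splitting.
  have hf : ∀ v, splitEdge c ∈ S v → s(c, x) ∈ R.edges v := by
    intro v hv
    by_contra hx
    obtain ⟨p, hp, -⟩ := hT.existsUnique_path (R.src v) (R.tgt v)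
    refine hv (R.reachable_splitLift (hN v hx) p fun e he => ?_)
    rwa [edges, ← edgeSet_eq_cut hT hp]
  have hmem : ∀ e ∈ (split T c N).edgeSet, e ≠ splitEdge c → ∀ v,
      e ∈ S v ↔ Sym2.map (merge c) e ∈ R.edges v := by
    intro e he hef v
    have := mem_cut_split_iff he hef
      (a := R.splitLift c N v (R.src v)) (b := R.splitLift c N v (R.tgt v))
    rwa [merge_splitLift, merge_splitLift] at this
  have hinter : ∀ v w, (S v ∩ S w).Nonempty → (R.edges v ∩ R.edges w).Nonempty := by
    rintro v w ⟨e, hv, hw⟩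
    by_cases hef : e = splitEdge c
    · subst hef
      exact ⟨_, hf v hv, hf w hw⟩
    · have he : e ∈ (split T c N).edgeSet := cut_subset_edgeSet hT'.connected hv
      exact ⟨_, (hmem e he hef v).1 hv, (hmem e he hef w).1 hw⟩
  have hlift : ∀ e ∈ T.edgeSet, ∃ e', ∀ v, e ∈ R.edges v → e' ∈ S v := by
    intro e he
    obtain ⟨e', he', hef, rfl⟩ := exists_lift_edge (c := c) (N := N) he
    exact ⟨e', fun v => (hmem e' he' hef v).2⟩
  refine ⟨⟨fun v => R.splitLift c N v (R.src v), fun v => R.splitLift c N v (R.tgt v),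
    fun v w => ?_, fun I hI hpair => ?_⟩⟩
  · rw [R.adj_iff]
    refine and_congr_right fun _ => ⟨?_, hinter v w⟩
    rintro ⟨e, hv, hw⟩
    obtain ⟨e', he'⟩ := hlift e (cut_subset_edgeSet hT.connected hv)
    exact ⟨e', he' v hv, he' w hw⟩
  -- Pairwise intersections descend to the old tree, and the common edge found there lifts back.
  · obtain ⟨e, he⟩ := R.helly I hI fun v hv w hw hvw => hinter v w (hpair hv hw hvw)
    rw [Set.mem_iInter₂] at he
    obtain ⟨v, hv⟩ := hI
    obtain ⟨e', he'⟩ := hlift e (cut_subset_edgeSet hT.connected (he v hv))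
    exact ⟨e', Set.mem_iInter₂.2 fun w hw => he' w (he w hw)⟩

/-- A disconnected link at a vertex of degree at least four allows a splitting that decreases
degrees. -/
theorem exists_split_set [Finite W] (hT : T.IsTree) (R : CutRep G T) {c x : W}
    (hdeg : 4 ≤ (T.neighborSet c).ncard) (hx : T.Adj c x) (hlink : ¬ (R.link c x).Preconnected) :
    ∃ N : Set W, (∀ v, s(c, x) ∉ R.edges v →
        (∀ y, s(c, y) ∈ R.edges v → y ∈ N) ∨ ∀ y, s(c, y) ∈ R.edges v → y ∉ N) ∧
      2 ≤ (T.neighborSet c ∩ N).ncard ∧ 2 ≤ (T.neighborSet c \ N).ncard := by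
  obtain ⟨y, hy⟩ := not_forall.1 hlink
  obtain ⟨z, hyz⟩ := not_forall.1 hy
  let S : Set W := Subtype.val '' ((R.link c x).connectedComponentMk y).supp
  have hmemS : ∀ u : {u // T.Adj c u ∧ u ≠ x}, u.1 ∈ S ↔ (R.link c x).Reachable u y := by
    intro u
    constructor
    · rintro ⟨u', hu', huu⟩
      rw [← Subtype.ext huu]
      exact ConnectedComponent.exact hu'
    · exact fun h => ⟨u, ConnectedComponent.sound h, rfl⟩
  have hxS : x ∉ S := by
    rintro ⟨u, -, hu⟩
    exact u.2.2 hu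
  have hyS : y.1 ∈ S := (hmemS y).2 (.refl _)
  have hzS : z.1 ∉ S := fun h => hyz ((hmemS z).1 h).symm
  have hsub : S ⊆ T.neighborSet c := by
    rintro _ ⟨u, -, rfl⟩
    exact u.2.1
  have hside : ∀ v, s(c, x) ∉ R.edges v → ∀ u w, s(c, u) ∈ R.edges v → s(c, w) ∈ R.edges v →
      u ∈ S → w ∈ S := by
    intro v hv u w hu hw huS
    have hu' : T.Adj c u ∧ u ≠ x :=
      ⟨cut_subset_edgeSet hT.connected hu, by rintro rfl; exact hv hu⟩
    have hw' : T.Adj c w ∧ w ≠ x :=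
      ⟨cut_subset_edgeSet hT.connected hw, by rintro rfl; exact hv hw⟩
    by_cases huw : u = w
    · exact huw ▸ huS
    have hadj : (R.link c x).Adj ⟨w, hw'⟩ ⟨u, hu'⟩ :=
      ⟨fun h => huw (congrArg Subtype.val h).symm, v, hv, hw, hu⟩
    exact (hmemS ⟨w, hw'⟩).2 (hadj.reachable.trans ((hmemS ⟨u, hu'⟩).1 huS))
  have hclosed : ∀ v, s(c, x) ∉ R.edges v →
      (∀ u, s(c, u) ∈ R.edges v → u ∈ S) ∨ ∀ u, s(c, u) ∈ R.edges v → u ∉ S := by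
    intro v hv
    by_contra! hcon
    obtain ⟨⟨u, hu, huS⟩, w, hw, hwS⟩ := hcon
    exact huS (hside v hv w u hw hu hwS)
  have hpair : ∀ {a b : W} {P : Set W}, a ∈ P → b ∈ P → a ≠ b → 2 ≤ P.ncard := by
    intro a b P ha hb hab
    exact (Set.one_lt_ncard (Set.toFinite _)).2 ⟨a, ha, b, hb, hab⟩
  -- The component `S` serves as `N` if it has two elements, as `x` and `z` lie outside it.
  -- Otherwise `N` consists of what lies outside `S` and differs from `x`: degree at least four
  -- leaves two such neighbours, and `x` and `y` are on the other side.
  by_cases hS : 2 ≤ S.ncard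
  · refine ⟨S, hclosed, by rwa [Set.inter_eq_right.2 hsub], ?_⟩
    exact hpair ⟨hx, hxS⟩ ⟨z.2.1, hzS⟩ z.2.2.symm
  · refine ⟨{w | w ∉ S ∧ w ≠ x}, fun v hv => ?_, ?_, ?_⟩
    · rcases hclosed v hv with h | h
      · exact Or.inr fun u hu hu' => hu'.1 (h u hu)
      · exact Or.inl fun u hu => ⟨h u hu, by rintro rfl; exact hv hu⟩
    · have heq : T.neighborSet c ∩ {w | w ∉ S ∧ w ≠ x} = T.neighborSet c \ insert x S := by
        ext w
        simp only [Set.mem_inter_iff, Set.mem_ofPred_eq, Set.mem_sdiff, Set.mem_insert_iff]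
        tauto
      have h₁ := Set.ncard_insert_le x S
      have h₂ := Set.ncard_le_ncard_sdiff_add_ncard (T.neighborSet c) (insert x S)
      rw [heq]
      omega
    · exact hpair (a := x) (b := y.1) ⟨hx, fun h => h.2 rfl⟩ ⟨y.2.1, fun h => h.1 hyS⟩ y.2.2.symm

end CutRep

/-! ### Adding pendant vertices to the host tree -/

section Pendant

variable {W : Type*} (T : SimpleGraph W) (c : W) (k : ℕ)

/-- The graph obtained from `T` by attaching `k` pendant vertices to `c`. -/
def pendant : SimpleGraph (W ⊕ Fin k) where
  Adj
    | .inl a, .inl b => T.Adj a b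
    | .inl a, .inr _ => a = c
    | .inr _, .inl b => b = c
    | .inr _, .inr _ => False
  symm := ⟨by
    rintro (a | i) (b | j) h
    · exact T.adj_symm h
    · exact h
    · exact h
    · exact h⟩
  loopless := ⟨by
    rintro (a | i) h
    · exact T.irrefl h
    · exact h⟩

/-- The inclusion of `T` into `pendant T c k`. -/
def pendantHom : T →g pendant T c k where
  toFun := .inl
  map_rel' h := h

variable {T c k}

theorem pendantHom_injective : Function.Injective (pendantHom T c k) := Sum.inl_injective

theorem isTree_pendant [Finite W] (hT : T.IsTree) : (pendant T c k).IsTree := by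
  have hreach : ∀ a, (pendant T c k).Reachable a (.inl c) := by
    rintro (a | i)
    · exact (hT.connected.preconnected a c).map (pendantHom T c k)
    · exact Adj.reachable (show (pendant T c k).Adj (.inr i) (.inl c) from rfl)
  have hconn : (pendant T c k).Connected :=
    { preconnected := fun a b => (hreach a).trans (hreach b).symm
      nonempty := ⟨.inl c⟩ }
  refine isTree_iff_connected_and_card.2 ⟨hconn, le_antisymm ?_
    hconn.card_vert_le_card_edgeSet_add_one⟩
  have h₁ := (isTree_iff_connected_and_card.1 hT).2
  have hsub : (pendant T c k).edgeSet ⊆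
      Sym2.map .inl '' T.edgeSet ∪ Set.range fun i => s(.inl c, .inr i) := by
    intro e he
    induction e with | _ a b =>
    rcases a with a | i <;> rcases b with b | j
    · exact Or.inl ⟨s(a, b), he, rfl⟩
    · obtain rfl : a = c := he
      exact Or.inr ⟨j, rfl⟩
    · obtain rfl : b = c := he
      exact Or.inr ⟨i, Sym2.eq_swap⟩
    · exact he.elim
  have h₂ := (Set.ncard_le_ncard hsub (Set.toFinite _)).trans (Set.ncard_union_le _ _)
  have h₃ := Set.ncard_image_le (f := Sym2.map (Sum.inl : W → W ⊕ Fin k)) (Set.toFinite T.edgeSet)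
  have h₄ : (Set.range fun i : Fin k => s((.inl c : W ⊕ Fin k), .inr i)).ncard ≤ k := by
    rw [← Set.image_univ]
    exact (Set.ncard_image_le (Set.toFinite _)).trans (by simp [Set.ncard_univ])
  have h₅ : Nat.card (W ⊕ Fin k) = Nat.card W + k := by simp [Nat.card_sum]
  rw [Nat.card_coe_set_eq] at h₁ ⊢
  omega

theorem ncard_neighborSet_pendant_self [Finite W] :
    ((pendant T c k).neighborSet (.inl c)).ncard = (T.neighborSet c).ncard + k := by
  have heq : (pendant T c k).neighborSet (.inl c) =
      Sum.inl '' T.neighborSet c ∪ Sum.inr '' Set.univ := by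
    ext (a | i)
    · simp [pendant]
    · simp [pendant]
  have hdisj : Disjoint (Sum.inl '' T.neighborSet c) (Sum.inr '' (Set.univ : Set (Fin k))) := by
    rw [Set.disjoint_left]
    rintro _ ⟨a, -, rfl⟩ ⟨i, -, h⟩
    cases h
  rw [heq, Set.ncard_union_eq hdisj (Set.toFinite _) (Set.toFinite _),
    Set.ncard_image_of_injective _ Sum.inl_injective,
    Set.ncard_image_of_injective _ Sum.inr_injective, Set.ncard_univ, Nat.card_fin]

theorem ncard_neighborSet_pendant_inl [Finite W] {a : W} (ha : a ≠ c) :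
    ((pendant T c k).neighborSet (.inl a)).ncard = (T.neighborSet a).ncard := by
  have heq : (pendant T c k).neighborSet (.inl a) = Sum.inl '' T.neighborSet a := by
    ext (b | i)
    · simp [pendant]
    · simp [pendant, ha]
  rw [heq, Set.ncard_image_of_injective _ Sum.inl_injective]

theorem ncard_neighborSet_pendant_inr (i : Fin k) :
    ((pendant T c k).neighborSet (.inr i)).ncard = 1 := by
  have heq : (pendant T c k).neighborSet (.inr i) = {.inl c} := by
    ext (b | j)
    · simp [pendant]
    · simp [pendant]
  rw [heq, Set.ncard_singleton]

end Pendant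

/-- The representation on a host graph containing `T`. -/
def PathRep.map {V W W' : Type*} {G : SimpleGraph V} {T : SimpleGraph W} {T' : SimpleGraph W'}
    (R : PathRep G T) (f : T →g T') (hf : Function.Injective f) : PathRep G T' where
  src v := f (R.src v)
  tgt v := f (R.tgt v)
  path v := (R.path v).map f
  isPath v := (R.isPath v).map hf
  adj_iff v w := by
    rw [R.adj_iff, Walk.edgeSet_map, Walk.edgeSet_map,
      ← Set.image_inter (Sym2.map.injective hf), Set.image_nonempty]

theorem HellyProperty.image {ι α β : Type*} {S : ι → Set α} (hS : HellyProperty S) {f : α → β}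
    (hf : Function.Injective f) : HellyProperty fun i => f '' S i := by
  intro I hI hpair
  obtain ⟨a, ha⟩ := hS I hI fun i hi j hj hij => by
    simpa only [← Set.image_inter hf, Set.image_nonempty] using hpair hi hj hij
  rw [Set.mem_iInter₂] at ha
  exact ⟨f a, Set.mem_iInter₂.2 fun i hi => ⟨a, ha i hi, rfl⟩⟩

theorem ncard_neighborSet_eq_degree {W : Type*} [Fintype W] (T : SimpleGraph W)
    [DecidableRel T.Adj] (w : W) : (T.neighborSet w).ncard = T.degree w := by
  rw [← card_neighborFinset_eq_degree, ← Set.ncard_coe_finset, coe_neighborFinset]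

/-- Pendant vertices raise the maximum degree of the host tree to any given bound. -/
theorem CutRep.isHellyDeg {V : Type*} {W : Type} [Fintype W] {G : SimpleGraph V}
    {T : SimpleGraph W} (hT : T.IsTree) (R : CutRep G T) {h : ℕ} (hh : 1 ≤ h)
    (hdeg : ∀ w, (T.neighborSet w).ncard ≤ h) : IsHellyDeg G h := by
  classical
  obtain ⟨R', hR'⟩ := R.exists_pathRep hT
  obtain ⟨c⟩ := hT.connected.nonempty
  -- Raises the degree of `c` to exactly `h`; the pendant vertices themselves have degree one, which
  -- is at most `h`.
  let k := h - (T.neighborSet c).ncard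
  have hc : ((pendant T c k).neighborSet (.inl c)).ncard = h := by
    rw [ncard_neighborSet_pendant_self]
    exact Nat.add_sub_of_le (hdeg c)
  refine ⟨W ⊕ Fin k, inferInstance, pendant T c k, Classical.decRel _, isTree_pendant hT,
    le_antisymm (maxDegree_le_of_forall_degree_le _ _ fun w => ?_) ?_,
    R'.map (pendantHom T c k) pendantHom_injective, ?_⟩
  · rw [← ncard_neighborSet_eq_degree]
    rcases w with w | i
    · by_cases hw : w = c
      · rw [hw, hc]
      · rw [ncard_neighborSet_pendant_inl hw]
        exact hdeg w
    · rwa [ncard_neighborSet_pendant_inr]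
  · rw [← hc, ncard_neighborSet_eq_degree]
    exact degree_le_maxDegree _ _
  · have := hR'.image (Sym2.map.injective (pendantHom_injective (T := T) (c := c) (k := k)))
    simpa only [PathRep.map, Walk.edgeSet_map] using this

/-! ### The induction on the excess and the theorem -/

/-- If all atoms have at most `h` cliques, splitting vertices leads to a host tree of maximum
degree at most `h`. -/
theorem CutRep.isHellyDeg_of_atoms {V : Type*} [Finite V] {G : SimpleGraph V} {h : ℕ} (hh : 3 ≤ h)
    (D : ∀ K : G.ConnectedComponent, CliqueDecompTree G K.supp)
    (hD : ∀ K, ∀ A ∈ (D K).atoms, {C : Set V | IsMaxClique G A C}.ncard ≤ h)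
    {W : Type} [Fintype W] {T : SimpleGraph W} (hT : T.IsTree) (R : CutRep G T) :
    IsHellyDeg G h := by
  classical
  induction hn : excess T using Nat.strong_induction_on generalizing W with
  | _ n ih =>
  subst hn
  by_cases hdeg : ∀ w, (T.neighborSet w).ncard ≤ h
  · exact R.isHellyDeg hT (by omega) hdeg
  push Not at hdeg
  obtain ⟨c, hc⟩ := hdeg
  by_cases hlink : ∀ x, T.Adj c x → (R.link c x).Preconnected
  · rw [ncard_neighborSet_eq_degree] at hc
    obtain ⟨K, A, hA, hle⟩ := R.exists_atom_degree_le hT (by omega) hlink D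
    exact absurd (hle.trans (hD K A hA)) (by omega)
  · push Not at hlink
    obtain ⟨x, hx, hlink⟩ := hlink
    -- The degree of `c` exceeds `h ≥ 3`, so it is at least four, as the splitting requires.
    obtain ⟨N, hN, h₁, h₂⟩ := R.exists_split_set hT (by omega) hx hlink
    obtain ⟨R'⟩ := R.exists_split hT hN
    exact ih _ (excess_split_lt h₁ h₂) (isTree_split hT) R' rfl

end HellyEPT

/-- `D` is a choice of one clique decomposition tree for each connected component of `G`. -/
theorem theorem4 {V : Type*} [Finite V] (G : SimpleGraph V) (hG : HellyEPT.IsHellyEPT G)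
    (h : ℕ) (hh : 3 ≤ h)
    (D : ∀ K : G.ConnectedComponent, HellyEPT.CliqueDecompTree G K.supp) :
    HellyEPT.IsHellyDeg G h ↔
      ∀ K : G.ConnectedComponent, ∀ A ∈ (D K).atoms,
        {C : Set V | HellyEPT.IsMaxClique G A C}.ncard ≤ h := by
  constructor
  · rintro ⟨W, _, T, _, hT, rfl, R, hR⟩ K A hA
    exact HellyEPT.ncard_isMaxClique_le hT (HellyEPT.CutRep.ofPathRep hT R hR)
      ((D K).isAtomSet_of_mem_atoms hA)
  · intro hD
    obtain ⟨W, _, T, hT, R, hR⟩ := hG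
    exact (HellyEPT.CutRep.ofPathRep hT R hR).isHellyDeg_of_atoms hh D hD hT
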